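/- For an integer $n \ge 1$, call a simple graph a split-complete graph $\widehat{K}_n$ if its $n+1$ vertices can be labelled with the numbers $1, 2, \dots, n-1$ and two letters $u$ and $v$ such that the numbered vertices are pairwise adjacent, and the neighborhoods of $u$ and $v$ partition the set of numbered vertices into two nonempty parts (in particular, $u$ and $v$ are not adjacent). A cellular embedding of a connected graph in a closed orientable surface $S_g$ of genus $g$ is described by its rotation system, i.e., a cyclic permutation, for each vertex, of the arcs leaving it; its faces are the cyclic sequences of arcs found by face-tracing, and $|V| - |E| + |F| = 2 - 2g$. The embedding is triangular if every face has exactly three sides. Theorem. For every integer $s \ge 1$ there exists a split-complete graph $\widehat{K}_{12s+10}$ (which has $12s+11$ vertices) with a triangular cellular embedding in an orientable surface $S_g$ for some $g\ge 0$. -/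

import Mathlib

/-- `G` is a split-complete graph `K̂ₙ`: its vertices can be labelled with the `n - 1` numbers
`1, …, n - 1` (represented by `Fin (n - 1)`) and two letters `u`, `v`, such that the numbered
vertices are pairwise adjacent and the neighbourhoods of `u` and `v` partition the set of numbered
vertices. Note that `K̂ₙ` has `n + 1` vertices; identifying `u` with `v` gives `Kₙ`. -/
def IsSplitComplete {V : Type*} (n : ℕ) (G : SimpleGraph V) : Prop :=
  1 ≤ n ∧ ∃ (num : Fin (n - 1) → V) (u v : V),
    -- the labels name every vertex exactly once
    Function.Injective num ∧ u ≠ v ∧ u ∉ Set.range num ∧ v ∉ Set.range num ∧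
    Set.range num ∪ {u, v} = Set.univ ∧
    -- the numbered vertices are pairwise adjacent
    (∀ i j : Fin (n - 1), i ≠ j → G.Adj (num i) (num j)) ∧
    -- the neighbours of `u` and `v` partition the numbered vertices
    (G.neighborSet u).Nonempty ∧ (G.neighborSet v).Nonempty ∧
    Disjoint (G.neighborSet u) (G.neighborSet v) ∧
    G.neighborSet u ∪ G.neighborSet v = Set.range num

/-- A rotation system of a simple graph: for every vertex a cyclic permutation of all the arcs
(darts) leaving that vertex, collected in one permutation `rot` of the set of all arcs. -/
structure RotationSystem {V : Type*} (G : SimpleGraph V) where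
  /-- `rot d` is the successor of the arc `d` in the rotation of the vertex that `d` leaves. -/
  rot : Equiv.Perm G.Dart
  /-- The rotation of a vertex permutes the arcs leaving it. -/
  fst_rot : ∀ d : G.Dart, (rot d).fst = d.fst
  /-- The rotation of a vertex is a single cycle through all the arcs leaving it. -/
  sameCycle_rot : ∀ d e : G.Dart, d.fst = e.fst → rot.SameCycle d e

namespace RotationSystem

variable {V : Type*} {G : SimpleGraph V}

/-- The face-tracing permutation: the arc from `a` to `b` is followed, on the boundary walk of
its face, by the arc from `b` to `c`, where `c` is the successor of `a` in the rotation of `b`. -/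
def faceNext (R : RotationSystem G) : Equiv.Perm G.Dart :=
  (SimpleGraph.Dart.symm_involutive (G := G)).toPerm.trans R.rot

/-- The faces of the embedding given by a rotation system: the cyclic arc sequences (orbits) found
by face-tracing. (For a connected graph with at least one edge every face has a side.) -/
def Face (R : RotationSystem G) : Type _ :=
  Quotient (Equiv.Perm.SameCycle.setoid R.faceNext)

/-- The number of sides of the face whose boundary walk contains the arc `d`. -/
noncomputable def sides (R : RotationSystem G) (d : G.Dart) : ℕ :=
  Function.minimalPeriod R.faceNext d

/-- `R` describes a cellular embedding of the graph `G` in the orientable surface `S_g` of genus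
`g`: the graph is connected, and the closed orientable surface obtained by gluing a disk along each
face boundary found by face-tracing has Euler characteristic `|V| - |E| + |F| = 2 - 2g`. -/
def IsCellularEmbedding (R : RotationSystem G) (g : ℕ) : Prop :=
  G.Connected ∧
    (Nat.card V : ℤ) - (Nat.card G.edgeSet : ℤ) + (Nat.card R.Face : ℤ) = 2 - 2 * (g : ℤ)

/-- The embedding is triangular: every face has exactly three sides. -/
def IsTriangular (R : RotationSystem G) : Prop :=
  ∀ d : G.Dart, R.sides d = 3

end RotationSystem

/-! The triangulation is invariant under translation by `ℤ/(4s+3)`, which acts on three classes of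
numbered vertices and fixes `u` and `v`. Thus `12s+10` base triangles describe all faces. The letter
`u` is joined to class `0`, and `v` to classes `1` and `2`.

Most base triangles form three ladders. The zigzag sequence has successive differences `c, -(c+1),
c+2, …`, so the triangles of ladder `r` run through consecutive differences inside class `r`. Each
such side is used in one direction by an upper triangle with apex in class `r+1`, and in the other
by a lower triangle with apex in class `r+2`. Ladder `2` exhausts the differences `1, …, 2s+1`;
ladder `0` omits `2s+1`, and ladder `1` omits `1` and `2s+1`. Ten further triangles absorb these
differences, join the ends of the rails and attach the letters.

It suffices to find, in the link of each vertex, a walk through all neighbours: since three times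
the number of triangles is twice the number of edges, each arc is then a side exactly once
(`exists_isTriangular_of_linkStep`). At a vertex of class `t` the walk runs along the upper rail of
ladder `t+2` and the lower rail of ladder `t+1`, and crosses ladder `t` in two zigzag passes
(`reach_zigzag_both`); the other triangles connect these pieces. The zigzag values form intervals of
residues, so coverage reduces to tiling `ℤ/(4s+3)` by intervals (`link_zero`, `link_one`,
`link_two`). -/

/-! ### Rotation systems from families of oriented triangles. -/

/-- `q` follows `p` in the link of `a`: some triangle of the family `tri` has the corners `a`, `p`,
`q` in this cyclic order. -/
def LinkStep {V J : Type*} (tri : J → Fin 3 → V) (a p q : V) : Prop :=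
  ∃ j k, tri j k = a ∧ tri j (k + 1) = p ∧ tri j (k + 2) = q

/-- A family of oriented triangles with as many sides as the graph has arcs, in which the link of
every vertex is connected and covers all neighbours, is the set of faces of a triangular rotation
system. -/
theorem exists_isTriangular_of_linkStep {V J : Type*} [Finite V] [Finite J] {G : SimpleGraph V}
    (tri : J → Fin 3 → V) (hadj : ∀ j k, G.Adj (tri j k) (tri j (k + 1)))
    (hlink : ∀ a, ∃ b, ∀ c, G.Adj a c → Relation.TransGen (LinkStep tri a) b c)
    (hcard : Nat.card J * 3 ≤ 2 * Nat.card G.edgeSet) :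
    ∃ R : RotationSystem G, R.IsTriangular ∧ Nat.card R.Face = Nat.card J := by
  classical
  have h3 : ∀ k : Fin 3, k + 2 + 1 = k := by decide
  have h111 : ∀ k : Fin 3, k + 1 + 1 + 1 = k := by decide
  let side : J × Fin 3 → G.Dart := fun x => ⟨(tri x.1 x.2, tri x.1 (x.2 + 1)), hadj x.1 x.2⟩
  have hfin : Finite G.Dart :=
    Finite.of_injective (fun d : G.Dart => d.toProd) (fun _ _ h => SimpleGraph.Dart.ext _ _ h)
  -- The last step of the link walk into `x` supplies the triangle; `TransGen` guarantees such a
  -- step even when `x` is the starting vertex.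
  have hsurj : Function.Surjective side := by
    rintro ⟨⟨x, y⟩, h⟩
    obtain ⟨b, hb⟩ := hlink y
    obtain ⟨p, -, j, k, h0, -, h2⟩ := Relation.TransGen.tail'_iff.1 (hb x h.symm)
    refine ⟨(j, k + 2), SimpleGraph.Dart.ext _ _ ?_⟩
    simp only [side, h3, h0, h2]
  -- Here the count replaces any check that two triangles never share a directed side.
  have hbij : Function.Bijective side :=
    hsurj.bijective_of_nat_card_le <| by
      have := Fintype.ofFinite V
      rw [Nat.card_eq_fintype_card (α := G.Dart), G.dart_card_eq_twice_card_edges,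
        SimpleGraph.edgeFinset_card, ← Nat.card_eq_fintype_card]
      simpa [Nat.card_prod] using hcard
  let e : J × Fin 3 ≃ G.Dart := Equiv.ofBijective side hbij
  let shift : Equiv.Perm (J × Fin 3) := Equiv.prodCongr (Equiv.refl J) (Equiv.addRight 1)
  let φ : Equiv.Perm G.Dart := (e.symm.trans shift).trans e
  have hφ : ∀ j k, φ (side (j, k)) = side (j, k + 1) := by
    intro j k
    have : e.symm (side (j, k)) = (j, k) := e.symm_apply_apply (j, k)
    simp only [φ, Equiv.trans_apply, this]
    rfl
  let flip : Equiv.Perm G.Dart := (SimpleGraph.Dart.symm_involutive (G := G)).toPerm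
  let rot : Equiv.Perm G.Dart := flip.trans φ
  have hrot : ∀ d : G.Dart, rot d.symm = φ d := fun d => by
    change φ d.symm.symm = φ d
    rw [SimpleGraph.Dart.symm_symm]
  -- The rotation runs against the link walk, so a connected link becomes a single cycle of `rot`.
  have hstep : ∀ a p q (hp : G.Adj a p) (hq : G.Adj a q), LinkStep tri a p q →
      rot ⟨(a, q), hq⟩ = ⟨(a, p), hp⟩ := by
    rintro _ _ _ hp hq ⟨j, k, rfl, rfl, rfl⟩
    have h1 : (⟨(tri j k, tri j (k + 2)), hq⟩ : G.Dart) = (side (j, k + 2)).symm :=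
      SimpleGraph.Dart.ext _ _ (by simp [side, h3])
    rw [h1, hrot, hφ, h3]
  have hadj1 : ∀ a p q, LinkStep tri a p q → G.Adj a p ∧ G.Adj a q := by
    rintro _ _ _ ⟨j, k, rfl, rfl, rfl⟩
    refine ⟨hadj j k, ?_⟩
    have := hadj j (k + 2)
    rw [h3] at this
    exact this.symm
  have hreach : ∀ a b c, Relation.TransGen (LinkStep tri a) b c → ∀ (hb : G.Adj a b)
      (hc : G.Adj a c), rot.SameCycle ⟨(a, b), hb⟩ ⟨(a, c), hc⟩ := by
    intro a b c h
    induction h with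
    | single h =>
      intro hb hc
      rw [← hstep _ _ _ hb hc h]
      exact (Equiv.Perm.SameCycle.refl _ _).apply_left
    | tail _ h ih =>
      intro hb hc
      have hm := (hadj1 _ _ _ h).1
      refine (ih hb hm).trans ?_
      rw [← hstep _ _ _ hm hc h]
      exact (Equiv.Perm.SameCycle.refl _ _).apply_left
  let R : RotationSystem G :=
    { rot := rot
      fst_rot := by
        intro d
        obtain ⟨⟨j, k⟩, hk⟩ := hsurj d.symm
        have hd : d = (side (j, k)).symm := by rw [hk, SimpleGraph.Dart.symm_symm]
        rw [hd, hrot, hφ]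
        rfl
      sameCycle_rot := by
        rintro ⟨⟨a, p⟩, hp⟩ ⟨⟨a', q⟩, hq⟩ h
        obtain rfl : a = a' := h
        obtain ⟨b, hb⟩ := hlink a
        obtain ⟨m, hm, -⟩ := Relation.TransGen.head'_iff.1 (hb p hp)
        have hab := (hadj1 _ _ _ hm).1
        exact (hreach _ _ _ (hb p hp) hab hp).symm.trans (hreach _ _ _ (hb q hq) hab hq) }
  have hface : ∀ d, R.faceNext d = φ d := fun d => hrot d
  have hfn : R.faceNext = φ := Equiv.ext hface
  refine ⟨R, ?_, ?_⟩
  · intro d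
    obtain ⟨⟨j, k⟩, rfl⟩ := hsurj d
    unfold RotationSystem.sides
    rw [hfn]
    refine Function.minimalPeriod_eq_prime (p := 3) ?_ ?_
    · change φ (φ (φ (side (j, k)))) = side (j, k)
      rw [hφ, hφ, hφ, h111]
    · intro h
      have h' : φ (side (j, k)) = side (j, k) := h
      rw [hφ] at h'
      have := congrArg Prod.snd (hbij.1 h')
      revert this
      simp
  -- Face-tracing never leaves a triangle, so its index in `J` is an invariant that identifies faces
  -- with `J`.
  · have hinv : ∀ n : ℤ, ∀ d, (e.symm ((φ ^ n) d)).1 = (e.symm d).1 := by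
      have hone : ∀ d, (e.symm (φ d)).1 = (e.symm d).1 := fun d => by
        simp only [φ, Equiv.trans_apply, Equiv.symm_apply_apply]
        rfl
      intro n
      induction n with
      | zero => intro d; simp
      | succ n ih => intro d; rw [add_comm, zpow_add, Equiv.Perm.mul_apply, zpow_one, hone, ih]
      | pred n ih =>
        intro d
        rw [sub_eq_neg_add, zpow_add, Equiv.Perm.mul_apply, zpow_neg_one, ← hone,
          ← Equiv.Perm.mul_apply, mul_inv_cancel, Equiv.Perm.one_apply, ih]
    refine Nat.card_congr (Equiv.ofBijective (Quotient.lift (fun d => (e.symm d).1) ?_) ⟨?_, ?_⟩)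
    · rintro d d' ⟨n, hn⟩
      rw [← hn, hfn]
      exact (hinv n d).symm
    · intro x y
      refine Quotient.inductionOn₂ x y fun d d' h => Quotient.sound ?_
      obtain ⟨⟨j, k⟩, rfl⟩ := e.surjective d
      obtain ⟨⟨j', k'⟩, rfl⟩ := e.surjective d'
      simp only [Quotient.lift_mk, Equiv.symm_apply_apply] at h
      subst h
      change R.faceNext.SameCycle _ _
      rw [hfn]
      have hs : ∀ k, φ.SameCycle (side (j, k)) (side (j, k + 1)) := fun k => by
        rw [← hφ]
        exact (Equiv.Perm.SameCycle.refl _ _).apply_right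
      have h0 : ∀ k, φ.SameCycle (side (j, 0)) (side (j, k)) := by
        intro k
        fin_cases k
        · exact Equiv.Perm.SameCycle.refl _ _
        · exact hs 0
        · exact (hs 0).trans (hs 1)
      exact (h0 k).symm.trans (h0 k')
    · intro j
      exact ⟨Quotient.mk _ (side (j, 0)), congrArg Prod.fst (e.symm_apply_apply (j, 0))⟩

/-! ### The translation-invariant family of triangles. -/

/-- Vertices of the triangulation: the numbered vertices are three copies of `ℤ/(4s+3)`, and
`Sum.inr true`, `Sum.inr false` are the letters `u`, `v`. -/
abbrev SplitVertex (s : ℕ) : Type := (Fin 3 × ZMod (4 * s + 3)) ⊕ Bool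

namespace SplitVertex

variable {s : ℕ}

/-- The numbered vertex `x` of class `r`. -/
def num (r : Fin 3) (x : ZMod (4 * s + 3)) : SplitVertex s := Sum.inl (r, x)

/-- The letter `u`. -/
def u : SplitVertex s := Sum.inr true

/-- The letter `v`. -/
def v : SplitVertex s := Sum.inr false

/-- The action of `ℤ/(4s+3)` by translation of the numbered vertices. -/
def translate (g : ZMod (4 * s + 3)) : SplitVertex s → SplitVertex s
  | Sum.inl (r, x) => num r (x + g)
  | Sum.inr b => Sum.inr b

theorem num_congr {r : Fin 3} {x y : ZMod (4 * s + 3)} (h : x = y) : num r x = num r y := h ▸ rfl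

theorem four_mul_add_three : (4 * s + 3 : ZMod (4 * s + 3)) = 0 := by
  exact_mod_cast ZMod.natCast_self (4 * s + 3)

/-- The zigzag sequence `0, c, -1, c + 1, -2, c + 2, …`. -/
def zig (s c k : ℕ) : ZMod (4 * s + 3) :=
  if Even k then -((k / 2 : ℕ) : ZMod (4 * s + 3)) else ((k / 2 : ℕ) : ZMod (4 * s + 3)) + c

theorem zig_even (c j : ℕ) : zig s c (2 * j) = -(j : ZMod (4 * s + 3)) := by
  simp [zig]

theorem zig_odd (c j : ℕ) : zig s c (2 * j + 1) = (j : ZMod (4 * s + 3)) + c := by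
  have h : (2 * j + 1) / 2 = j := by omega
  simp [zig, h]

theorem zig_zero (c : ℕ) : zig s c 0 = 0 := by simpa using zig_even (s := s) c 0

/-- The sign alternates with the parity of `k`; later only the unsigned difference matters, as each
rung is seen from both ends. -/
theorem zig_step (c k : ℕ) : zig s c (k + 1) - zig s c k = (k + c : ℕ) ∨
    zig s c (k + 1) - zig s c k = -((k + c : ℕ) : ZMod (4 * s + 3)) := by
  obtain ⟨j, rfl | rfl⟩ := Nat.even_or_odd' k
  · left
    rw [zig_even, zig_odd]
    push_cast
    ring
  · right
    rw [zig_odd, show 2 * j + 1 + 1 = 2 * (j + 1) by ring, zig_even]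
    push_cast
    ring

/-- The number of rungs of the ladder of class `r`. -/
def len (s : ℕ) : Fin 3 → ℕ := ![2 * s, 2 * s - 1, 2 * s + 1]

/-- The first rung of the ladder of class `r`. -/
def gap : Fin 3 → ℕ := ![1, 2, 1]

/-- The first value on the upper rail of the ladder of class `r`. -/
def top (s : ℕ) : Fin 3 → ZMod (4 * s + 3) := ![0, 0, -2]

/-- The first value on the lower rail of the ladder of class `r`. -/
def bot (s : ℕ) : Fin 3 → ZMod (4 * s + 3) := ![2 * s + 3, 2 * s + 3, 2 * s + 1]

/-- The triangles of the ladders: for each class, rung and rail. -/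
def ladder (s : ℕ) (r : Fin 3) (k : ℕ) : Bool → Fin 3 → SplitVertex s
  | true => ![num (r + 1) 0, num r (top s r + zig s (gap r) k),
      num r (top s r + zig s (gap r) (k + 1))]
  | false => ![num (r + 2) 0, num r (bot s r - zig s (gap r) k),
      num r (bot s r - zig s (gap r) (k + 1))]

/-- The triangles outside the ladders. -/
def gadget (s : ℕ) : Fin 10 → Fin 3 → SplitVertex s :=
  ![![num 0 0, num 0 (2 * s + 1), num 2 (-2)],
    ![num 0 0, num 1 0, num 1 (2 * s + 2)],
    ![num 0 0, num 1 (s + 1), num 2 s],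
    ![num 0 0, num 1 (s + 2), num 1 (s + 1)],
    ![num 0 0, num 1 (2 * s + 2), num 1 (2 * s + 3)],
    ![num 0 0, num 2 (s - 1), num 1 s],
    ![num 1 0, num 1 (2 * s + 1), num 2 (2 * s + 1)],
    ![u, num 0 0, num 0 (2 * s + 2)],
    ![v, num 1 0, num 2 s],
    ![v, num 2 0, num 1 (s + 1)]]

/-- Representatives of the triangles under translation. -/
def baseTri (s : ℕ) : ((Σ r : Fin 3, Fin (len s r) × Bool) ⊕ Fin 10) → Fin 3 → SplitVertex s
  | Sum.inl ⟨r, k, b⟩ => ladder s r k b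
  | Sum.inr i => gadget s i

/-- The oriented triangles of the triangulation. -/
def tri (s : ℕ) (j : ((Σ r : Fin 3, Fin (len s r) × Bool) ⊕ Fin 10) × ZMod (4 * s + 3))
    (k : Fin 3) : SplitVertex s :=
  translate j.2 (baseTri s j.1 k)

/-! ### Link steps given by ladder triangles. -/

section Steps

variable {r : Fin 3} (x : ZMod (4 * s + 3)) {k : ℕ}

theorem linkStep_top (hk : k < len s r) : LinkStep (tri s) (num (r + 1) x)
    (num r (x + (top s r + zig s (gap r) k))) (num r (x + (top s r + zig s (gap r) (k + 1)))) :=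
  ⟨(Sum.inl ⟨r, ⟨k, hk⟩, true⟩, x), 0, num_congr (by ring), num_congr (by ring),
    num_congr (by ring)⟩

theorem linkStep_bot (hk : k < len s r) : LinkStep (tri s) (num (r + 2) x)
    (num r (x + (bot s r - zig s (gap r) k))) (num r (x + (bot s r - zig s (gap r) (k + 1)))) :=
  ⟨(Sum.inl ⟨r, ⟨k, hk⟩, false⟩, x), 0, num_congr (by ring), num_congr (by ring),
    num_congr (by ring)⟩

/-- The translation is chosen so that a corner other than the apex lands on `x`; the link then moves
between a rung and a rail. -/
theorem linkStep_rung_top (hk : k < len s r) : LinkStep (tri s) (num r x)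
    (num r (x + (zig s (gap r) (k + 1) - zig s (gap r) k)))
    (num (r + 1) (x + -(top s r + zig s (gap r) k))) :=
  ⟨(Sum.inl ⟨r, ⟨k, hk⟩, true⟩, x - (top s r + zig s (gap r) k)), 1, num_congr (by ring),
    num_congr (by ring), num_congr (by ring)⟩

theorem linkStep_top_rung (hk : k < len s r) : LinkStep (tri s) (num r x)
    (num (r + 1) (x + -(top s r + zig s (gap r) (k + 1))))
    (num r (x + -(zig s (gap r) (k + 1) - zig s (gap r) k))) :=
  ⟨(Sum.inl ⟨r, ⟨k, hk⟩, true⟩, x - (top s r + zig s (gap r) (k + 1))), 2, num_congr (by ring),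
    num_congr (by ring), num_congr (by ring)⟩

theorem linkStep_rung_bot (hk : k < len s r) : LinkStep (tri s) (num r x)
    (num r (x + -(zig s (gap r) (k + 1) - zig s (gap r) k)))
    (num (r + 2) (x + -(bot s r - zig s (gap r) k))) :=
  ⟨(Sum.inl ⟨r, ⟨k, hk⟩, false⟩, x - (bot s r - zig s (gap r) k)), 1, num_congr (by ring),
    num_congr (by ring), num_congr (by ring)⟩

theorem linkStep_bot_rung (hk : k < len s r) : LinkStep (tri s) (num r x)
    (num (r + 2) (x + -(bot s r - zig s (gap r) (k + 1))))
    (num r (x + (zig s (gap r) (k + 1) - zig s (gap r) k))) :=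
  ⟨(Sum.inl ⟨r, ⟨k, hk⟩, false⟩, x - (bot s r - zig s (gap r) (k + 1))), 2, num_congr (by ring),
    num_congr (by ring), num_congr (by ring)⟩

end Steps

/-! ### Walks along and through a ladder. -/

open Relation

theorem reach_of_step {α : Type*} {step : α → α → Prop} {f : ℕ → α} {n : ℕ}
    (h : ∀ k < n, step (f k) (f (k + 1))) {a : α} (ha : ReflTransGen step a (f 0)) :
    ∀ k ≤ n, ReflTransGen step a (f k) := by
  intro k
  induction k with
  | zero => exact fun _ => ha
  | succ k ih => exact fun hk => (ih (by omega)).tail (h k hk)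

/-- Each step down the ladder crosses from one rail to the other by a rung vertex, so the current
rail is determined by the parity of the number of steps. The passes from the two rails use opposite
parities and are therefore complementary. -/
theorem reach_zigzag {α : Type*} {step : α → α → Prop} {f g p q : ℕ → α} {n : ℕ}
    (hf : ∀ k < n, step (f (k + 1)) (p k) ∧ step (p k) (g k))
    (hg : ∀ k < n, step (g (k + 1)) (q k) ∧ step (q k) (f k)) {a : α}
    (ha : ReflTransGen step a (f n)) :
    ∀ i ≤ n, (ReflTransGen step a (if Even i then f (n - i) else g (n - i))) ∧
      (i < n → ReflTransGen step a (if Even i then p (n - i - 1) else q (n - i - 1))) := by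
  have key : ∀ i ≤ n, ReflTransGen step a (if Even i then f (n - i) else g (n - i)) →
      i < n → ReflTransGen step a (if Even i then p (n - i - 1) else q (n - i - 1)) := by
    intro i _ h hi
    have e : n - i = n - i - 1 + 1 := by omega
    split_ifs at h ⊢
    · rw [e] at h
      exact h.tail (hf _ (by omega)).1
    · rw [e] at h
      exact h.tail (hg _ (by omega)).1
  intro i
  induction i with
  | zero => exact fun h0 => ⟨by simpa using ha, key 0 h0 (by simpa using ha)⟩
  | succ i ih =>
    intro hi
    suffices h : ReflTransGen step a (if Even (i + 1) then f (n - (i + 1)) else g (n - (i + 1)))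
      from ⟨h, key _ hi h⟩
    have h := (ih (by omega)).2 hi
    rw [show n - (i + 1) = n - i - 1 by omega]
    by_cases he : Even i
    · rw [if_pos he] at h
      rw [if_neg (by simpa [Nat.even_add_one] using he)]
      exact h.tail (hf _ (by omega)).2
    · rw [if_neg he] at h
      rw [if_pos (by simpa [Nat.even_add_one] using he)]
      exact h.tail (hg _ (by omega)).2

/-- Both zigzag passes through a ladder together visit both rails and all rungs. -/
theorem reach_zigzag_both {α : Type*} {step : α → α → Prop} {f g p q : ℕ → α} {n : ℕ}
    (hf : ∀ k < n, step (f (k + 1)) (p k) ∧ step (p k) (g k))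
    (hg : ∀ k < n, step (g (k + 1)) (q k) ∧ step (q k) (f k)) {a : α}
    (ha : ReflTransGen step a (f n)) (hb : ReflTransGen step a (g n)) :
    (∀ k ≤ n, ReflTransGen step a (f k) ∧ ReflTransGen step a (g k)) ∧
      ∀ k < n, ReflTransGen step a (p k) ∧ ReflTransGen step a (q k) := by
  have h1 := reach_zigzag hf hg ha
  have h2 := reach_zigzag hg hf hb
  constructor
  · intro k hk
    have e : n - (n - k) = k := by omega
    have h1 := (h1 (n - k) (by omega)).1
    have h2 := (h2 (n - k) (by omega)).1
    rw [e] at h1 h2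
    split_ifs at h1 h2
    exacts [⟨h1, h2⟩, ⟨h2, h1⟩]
  · intro k hk
    have e : n - (n - k - 1) - 1 = k := by omega
    have h1 := (h1 (n - k - 1) (by omega)).2 (by omega)
    have h2 := (h2 (n - k - 1) (by omega)).2 (by omega)
    rw [e] at h1 h2
    split_ifs at h1 h2
    exacts [⟨h1, h2⟩, ⟨h2, h1⟩]

/-- The passes along the rails and rungs of a ladder, for the vertices of its own class. -/
theorem reach_ladder (r : Fin 3) (x : ZMod (4 * s + 3)) {a : SplitVertex s}
    (ha : ReflTransGen (LinkStep (tri s) (num r x)) a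
      (num (r + 1) (x + -(top s r + zig s (gap r) (len s r)))))
    (hb : ReflTransGen (LinkStep (tri s) (num r x)) a
      (num (r + 2) (x + -(bot s r - zig s (gap r) (len s r))))) :
    (∀ k ≤ len s r,
      ReflTransGen (LinkStep (tri s) (num r x)) a (num (r + 1) (x + -(top s r + zig s (gap r) k))) ∧
      ReflTransGen (LinkStep (tri s) (num r x)) a
        (num (r + 2) (x + -(bot s r - zig s (gap r) k)))) ∧
    ∀ n, gap r ≤ n → n < len s r + gap r →
      ReflTransGen (LinkStep (tri s) (num r x)) a (num r (x + n)) ∧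
      ReflTransGen (LinkStep (tri s) (num r x)) a (num r (x + -n)) := by
  obtain ⟨h1, h2⟩ := reach_zigzag_both
    (f := fun k => num (r + 1) (x + -(top s r + zig s (gap r) k)))
    (g := fun k => num (r + 2) (x + -(bot s r - zig s (gap r) k)))
    (fun k hk => ⟨linkStep_top_rung x hk, linkStep_rung_bot x hk⟩)
    (fun k hk => ⟨linkStep_bot_rung x hk, linkStep_rung_top x hk⟩) ha hb
  refine ⟨h1, fun n hn hn' => ?_⟩
  obtain ⟨k, rfl⟩ := Nat.exists_eq_add_of_le' hn
  have h := h2 k (by omega)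
  rcases zig_step (s := s) (gap r) k with e | e
  · rw [e] at h
    exact h.symm
  · rw [e, neg_neg] at h
    exact h

/-- The end of the zigzag pass that starts on the upper rail. -/
theorem reach_zigzag_end (r : Fin 3) (x : ZMod (4 * s + 3)) {a : SplitVertex s}
    (ha : ReflTransGen (LinkStep (tri s) (num r x)) a
      (num (r + 1) (x + -(top s r + zig s (gap r) (len s r))))) :
    ReflTransGen (LinkStep (tri s) (num r x)) a
      (if Even (len s r) then num (r + 1) (x + -top s r) else num (r + 2) (x + -bot s r)) := by
  have h := (reach_zigzag
    (f := fun k => num (r + 1) (x + -(top s r + zig s (gap r) k)))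
    (g := fun k => num (r + 2) (x + -(bot s r - zig s (gap r) k)))
    (fun k hk => ⟨linkStep_top_rung x hk, linkStep_rung_bot x hk⟩)
    (fun k hk => ⟨linkStep_bot_rung x hk, linkStep_rung_top x hk⟩) ha (len s r) le_rfl).1
  simpa [zig_zero] using h

/-- The end of the zigzag pass that starts on the lower rail. -/
theorem reach_zigzag_end' (r : Fin 3) (x : ZMod (4 * s + 3)) {a : SplitVertex s}
    (hb : ReflTransGen (LinkStep (tri s) (num r x)) a
      (num (r + 2) (x + -(bot s r - zig s (gap r) (len s r))))) :
    ReflTransGen (LinkStep (tri s) (num r x)) a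
      (if Even (len s r) then num (r + 2) (x + -bot s r) else num (r + 1) (x + -top s r)) := by
  have h := (reach_zigzag
    (g := fun k => num (r + 1) (x + -(top s r + zig s (gap r) k)))
    (f := fun k => num (r + 2) (x + -(bot s r - zig s (gap r) k)))
    (fun k hk => ⟨linkStep_bot_rung x hk, linkStep_rung_top x hk⟩)
    (fun k hk => ⟨linkStep_top_rung x hk, linkStep_rung_bot x hk⟩) hb (len s r) le_rfl).1
  simpa [zig_zero] using h

theorem reach_top (r : Fin 3) (x : ZMod (4 * s + 3)) {a : SplitVertex s}
    (ha : ReflTransGen (LinkStep (tri s) (num (r + 1) x)) a (num r (x + top s r))) :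
    ∀ k ≤ len s r, ReflTransGen (LinkStep (tri s) (num (r + 1) x)) a
      (num r (x + (top s r + zig s (gap r) k))) :=
  reach_of_step (f := fun k => num r (x + (top s r + zig s (gap r) k)))
    (fun _ hk => linkStep_top x hk) (by simpa [zig_zero] using ha)

theorem reach_bot (r : Fin 3) (x : ZMod (4 * s + 3)) {a : SplitVertex s}
    (ha : ReflTransGen (LinkStep (tri s) (num (r + 2) x)) a (num r (x + bot s r))) :
    ∀ k ≤ len s r, ReflTransGen (LinkStep (tri s) (num (r + 2) x)) a
      (num r (x + (bot s r - zig s (gap r) k))) :=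
  reach_of_step (f := fun k => num r (x + (bot s r - zig s (gap r) k)))
    (fun _ hk => linkStep_bot x hk) (by simpa [zig_zero] using ha)

/-! ### Ladder ends and coverage of residues. -/

theorem zig_len_zero : zig s 1 (2 * s) = -s := zig_even 1 s

theorem zig_len_one (hs : 1 ≤ s) : zig s 2 (2 * s - 1) = s + 1 := by
  obtain ⟨j, rfl⟩ := Nat.exists_eq_add_of_le' hs
  rw [show 2 * (j + 1) - 1 = 2 * j + 1 by omega, zig_odd]
  push_cast
  ring

theorem zig_len_two : zig s 1 (2 * s + 1) = s + 1 := by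
  rw [zig_odd, Nat.cast_one]

/-- Even and odd terms of the zigzag sequence trace two intervals of residues. Isolating the
equation for `d` leaves only an identity modulo `4s+3` to check in each application. -/
theorem zig_cover {W : SplitVertex s → Prop} {r : Fin 3} {x : ZMod (4 * s + 3)}
    (F : ZMod (4 * s + 3) → ZMod (4 * s + 3)) {c m : ℕ}
    (h : ∀ k ≤ m, W (num r (x + F (zig s c k)))) :
    (∀ j, 2 * j ≤ m → ∀ d, F (-j) = d → W (num r (x + d))) ∧
      ∀ j, 2 * j + 1 ≤ m → ∀ d, F (j + c) = d → W (num r (x + d)) := by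
  refine ⟨fun j hj d hd => ?_, fun j hj d hd => ?_⟩
  · rw [← hd, ← zig_even]
    exact h _ hj
  · rw [← hd, ← zig_odd]
    exact h _ hj

theorem cast_congr {a b : ℕ} (h : a = b) : (a : ZMod (4 * s + 3)) = b := h ▸ rfl

theorem exists_natCast (d : ZMod (4 * s + 3)) : ∃ n < 4 * s + 3, (n : ZMod (4 * s + 3)) = d :=
  ⟨d.val, d.val_lt, d.natCast_zmod_val⟩

theorem rung_cover {W : SplitVertex s → Prop} {r : Fin 3} {x : ZMod (4 * s + 3)}
    (h : ∀ n : ℕ, 1 ≤ n → n ≤ 2 * s + 1 → W (num r (x + n)) ∧ W (num r (x + -n))) :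
    ∀ d ≠ 0, W (num r (x + d)) := by
  intro d hd
  obtain ⟨n, hn, rfl⟩ := exists_natCast d
  have hn0 : n ≠ 0 := by
    rintro rfl
    simp at hd
  by_cases hn' : n ≤ 2 * s + 1
  · exact (h n (by omega) hn').1
  · obtain ⟨m, hm⟩ : ∃ m, n + m = 4 * s + 3 := ⟨4 * s + 3 - n, by omega⟩
    have e := cast_congr (s := s) hm
    rw [ZMod.natCast_self, Nat.cast_add] at e
    rw [eq_neg_of_add_eq_zero_left e]
    exact (h m (by omega) (by omega)).2

/-- All neighbours of a numbered vertex are found once every class is. -/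
theorem forall_neighbor {W : SplitVertex s → Prop} {x : ZMod (4 * s + 3)} (r : Fin 3)
    (h0 : ∀ d ≠ 0, W (num r (x + d))) (h1 : ∀ d, W (num (r + 1) (x + d)))
    (h2 : ∀ d, W (num (r + 2) (x + d))) : ∀ y, y ≠ (r, x) → W (Sum.inl y) := by
  rintro ⟨t, y⟩ hy
  obtain ⟨d, rfl⟩ : ∃ d, y = x + d := ⟨y - x, by ring⟩
  have ht : t = r ∨ t = r + 1 ∨ t = r + 2 := by
    clear * -
    revert t r
    decide
  rcases ht with rfl | rfl | rfl
  · exact h0 d (by rintro rfl; simp at hy)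
  · exact h1 d
  · exact h2 d

/-! ### Links of the numbered vertices. -/

/-- The link of a numbered vertex of class `0` passes through all its neighbours. -/
theorem link_zero (hs : 1 ≤ s) (x : ZMod (4 * s + 3)) :
    (∀ y, y ≠ (0, x) → TransGen (LinkStep (tri s) (num 0 x)) (num 1 x) (Sum.inl y)) ∧
      TransGen (LinkStep (tri s) (num 0 x)) (num 1 x) u := by
  have hq := four_mul_add_three (s := s)
  have e0 := zig_len_zero (s := s)
  have e1 := zig_len_one hs
  have e2 := zig_len_two (s := s)
  -- The first step of the closed walk is split off; the rest must return to `num 1 x`.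
  have h0 : LinkStep (tri s) (num 0 x) (num 1 x) (num 1 (x + (2 * s + 2))) :=
    ⟨(Sum.inr 1, x), 0, num_congr (by grind), num_congr (by grind), num_congr (by grind)⟩
  suffices h : (∀ y, y ≠ (0, x) →
      ReflTransGen (LinkStep (tri s) (num 0 x)) (num 1 (x + (2 * s + 2))) (Sum.inl y)) ∧
      ReflTransGen (LinkStep (tri s) (num 0 x)) (num 1 (x + (2 * s + 2))) u from
    ⟨fun y hy => TransGen.head' h0 (h.1 y hy), TransGen.head' h0 h.2⟩
  -- `W` holds for the link vertices already reached.
  generalize hW : ReflTransGen (LinkStep (tri s) (num 0 x)) (num 1 (x + (2 * s + 2))) = W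
  have step : ∀ {y z}, W y → LinkStep (tri s) (num 0 x) y z → W z := by
    subst hW
    exact fun h h' => h.tail h'
  have c0 : W (num 1 (x + (2 * s + 2))) := by
    subst hW
    exact ReflTransGen.refl
  have c1 : W (num 1 (x + (2 * s + 3))) := step c0
    ⟨(Sum.inr 4, x), 0, num_congr (by grind), num_congr (by grind), num_congr (by grind)⟩
  have p1 : ∀ k ≤ 2 * s - 1, W (num 1 (x + (2 * s + 3 - zig s 2 k))) := by
    subst hW
    exact reach_bot 1 x c1
  have c2 : W (num 1 (x + (s + 1))) := step (p1 _ le_rfl)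
    ⟨(Sum.inr 3, x), 0, num_congr (by grind), num_congr (by grind), num_congr (by grind)⟩
  have c3 : W (num 2 (x + s)) := step c2
    ⟨(Sum.inr 2, x), 0, num_congr (by grind), num_congr (by grind), num_congr (by grind)⟩
  have z1' : W (num 2 (x + -(2 * s + 3 - zig s 1 (2 * s)))) := by
    convert c3 using 2
    grind
  -- Ladder `0` has evenly many rungs, so a pass leaves on the rail where it entered.
  have z1 : W (num 2 (x + -(2 * s + 3))) := by
    subst hW
    simpa [len, gap, top, bot] using reach_zigzag_end' 0 x z1'
  have c5 : W (num 0 (x + (2 * s + 2))) := step z1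
    ⟨(Sum.inr 0, x - (2 * s + 1)), 1, num_congr (by grind), num_congr (by grind), num_congr (by grind)⟩
  have cl : W (u) := step c5
    ⟨(Sum.inr 7, x), 1, num_congr (by grind), num_congr (by grind), rfl⟩
  have c6 : W (num 0 (x + (2 * s + 1))) := step cl
    ⟨(Sum.inr 7, x - (2 * s + 2)), 2, num_congr (by grind), rfl, num_congr (by grind)⟩
  have c7 : W (num 2 (x + -2)) := step c6
    ⟨(Sum.inr 0, x), 0, num_congr (by grind), num_congr (by grind), num_congr (by grind)⟩
  have p2 : ∀ k ≤ 2 * s + 1, W (num 2 (x + (-2 + zig s 1 k))) := by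
    subst hW
    exact reach_top 2 x c7
  have c8 : W (num 1 (x + s)) := step (p2 _ le_rfl)
    ⟨(Sum.inr 5, x), 0, num_congr (by grind), num_congr (by grind), num_congr (by grind)⟩
  have z2' : W (num 1 (x + -(0 + zig s 1 (2 * s)))) := by
    convert c8 using 2
    grind
  -- This closes the walk.
  have z2 : W (num 1 (x + -0)) := by
    subst hW
    simpa [len, gap, top, bot] using reach_zigzag_end 0 x z2'
  obtain ⟨hr, hm⟩ : (∀ k ≤ 2 * s, W (num 1 (x + -(0 + zig s 1 k))) ∧
      W (num 2 (x + -(2 * s + 3 - zig s 1 k)))) ∧ ∀ n : ℕ, 1 ≤ n → n < 2 * s + 1 →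
      W (num 0 (x + n)) ∧ W (num 0 (x + -n)) := by
    subst hW
    exact reach_ladder 0 x z2' z1'
  refine ⟨forall_neighbor 0 (rung_cover fun n h1 h2 => ?_) ?_ ?_, cl⟩
  · rcases Nat.lt_or_ge n (2 * s + 1) with h | h
    · exact hm n h1 h
    · obtain rfl : n = 2 * s + 1 := by omega
      constructor
      · convert c6 using 3
        push_cast
        ring
      · convert c5 using 3
        push_cast
        grind
  · have A := zig_cover (fun z => 2 * s + 3 - z) p1
    have B := zig_cover (fun z => -(0 + z)) fun k hk => (hr k hk).1
    intro d
    obtain ⟨n, hn, rfl⟩ := exists_natCast d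
    -- Each rail contributes two intervals; they miss only `s + 1` and `2 * s + 2`, which are met
    -- between the ladders.
    obtain h | h | h | h | h | h : n ≤ s ∨ n = s + 1 ∨ s + 2 ≤ n ∧ n ≤ 2 * s + 1 ∨ n = 2 * s + 2 ∨ 2 * s + 3 ≤ n ∧ n ≤ 3 * s + 2 ∨ 3 * s + 3 ≤ n := by omega
    · obtain ⟨j, hj⟩ : ∃ j, n = j := ⟨n, by omega⟩
      have e := cast_congr (s := s) hj
      exact B.1 j (by omega) _ (by clear * - hq e; grind)
    · have e := cast_congr (s := s) h
      push_cast at e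
      rw [show (n : ZMod (4 * s + 3)) = s + 1 by clear * - hq e; grind]
      exact c2
    · obtain ⟨j, hj⟩ : ∃ j, n + j = 2 * s + 1 := ⟨2 * s + 1 - n, by omega⟩
      have e := cast_congr (s := s) hj
      push_cast at e
      exact A.2 j (by omega) _ (by clear * - hq e; grind)
    · have e := cast_congr (s := s) h
      push_cast at e
      rw [show (n : ZMod (4 * s + 3)) = 2 * s + 2 by clear * - hq e; grind]
      exact c0
    · obtain ⟨j, hj⟩ : ∃ j, n = 2 * s + 3 + j := ⟨n - (2 * s + 3), by omega⟩
      have e := cast_congr (s := s) hj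
      push_cast at e
      exact A.1 j (by omega) _ (by clear * - hq e; grind)
    · obtain ⟨j, hj⟩ : ∃ j, n + j + 1 = 4 * s + 3 := ⟨4 * s + 2 - n, by omega⟩
      have e := cast_congr (s := s) hj
      push_cast at e
      exact B.2 j (by omega) _ (by clear * - hq e; grind)
  · have A := zig_cover (fun z => -2 + z) p2
    have B := zig_cover (fun z => -(2 * s + 3 - z)) fun k hk => (hr k hk).2
    intro d
    obtain ⟨n, hn, rfl⟩ := exists_natCast d
    obtain h | h | h | h | h | h : 1 ≤ n ∧ n < s ∨ n = 0 ∨ s ≤ n ∧ n ≤ 2 * s ∨ 2 * s + 1 ≤ n ∧ n ≤ 3 * s ∨ 3 * s + 1 ≤ n ∧ n ≤ 4 * s + 1 ∨ n = 4 * s + 2 := by omega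
    · obtain ⟨j, hj⟩ : ∃ j, n + 1 = j := ⟨n + 1, by omega⟩
      have e := cast_congr (s := s) hj
      push_cast at e
      exact A.2 j (by omega) _ (by clear * - hq e; grind)
    · obtain ⟨j, hj⟩ : ∃ j, n + 1 = j := ⟨n + 1, by omega⟩
      have e := cast_congr (s := s) hj
      push_cast at e
      exact A.2 j (by omega) _ (by clear * - hq e; grind)
    · obtain ⟨j, hj⟩ : ∃ j, n + j = 2 * s := ⟨2 * s - n, by omega⟩
      have e := cast_congr (s := s) hj
      push_cast at e
      exact B.1 j (by omega) _ (by clear * - hq e; grind)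
    · obtain ⟨j, hj⟩ : ∃ j, n = 2 * s + 1 + j := ⟨n - (2 * s + 1), by omega⟩
      have e := cast_congr (s := s) hj
      push_cast at e
      exact B.2 j (by omega) _ (by clear * - hq e; grind)
    · obtain ⟨j, hj⟩ : ∃ j, n + j = 4 * s + 1 := ⟨4 * s + 1 - n, by omega⟩
      have e := cast_congr (s := s) hj
      push_cast at e
      exact A.1 j (by omega) _ (by clear * - hq e; grind)
    · obtain ⟨j, hj⟩ : ∃ j, n = 4 * s + 2 + j := ⟨0, by omega⟩
      have e := cast_congr (s := s) hj
      push_cast at e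
      exact A.2 j (by omega) _ (by clear * - hq e; grind)

/-- The link of a numbered vertex of class `1` passes through all its neighbours. -/
theorem link_one (hs : 1 ≤ s) (x : ZMod (4 * s + 3)) :
    (∀ y, y ≠ (1, x) → TransGen (LinkStep (tri s) (num 1 x)) (num 2 x) (Sum.inl y)) ∧
      TransGen (LinkStep (tri s) (num 1 x)) (num 2 x) v := by
  have hq := four_mul_add_three (s := s)
  have e0 := zig_len_zero (s := s)
  have e1 := zig_len_one hs
  have e2 := zig_len_two (s := s)
  have h0 : LinkStep (tri s) (num 1 x) (num 2 x) (num 1 (x + (2 * s + 2))) :=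
    ⟨(Sum.inr 6, x - (2 * s + 1)), 1, num_congr (by grind), num_congr (by grind), num_congr (by grind)⟩
  suffices h : (∀ y, y ≠ (1, x) →
      ReflTransGen (LinkStep (tri s) (num 1 x)) (num 1 (x + (2 * s + 2))) (Sum.inl y)) ∧
      ReflTransGen (LinkStep (tri s) (num 1 x)) (num 1 (x + (2 * s + 2))) v from
    ⟨fun y hy => TransGen.head' h0 (h.1 y hy), TransGen.head' h0 h.2⟩
  generalize hW : ReflTransGen (LinkStep (tri s) (num 1 x)) (num 1 (x + (2 * s + 2))) = W
  have step : ∀ {y z}, W y → LinkStep (tri s) (num 1 x) y z → W z := by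
    subst hW
    exact fun h h' => h.tail h'
  have c0 : W (num 1 (x + (2 * s + 2))) := by
    subst hW
    exact ReflTransGen.refl
  have c1 : W (num 0 (x + 0)) := step c0
    ⟨(Sum.inr 1, x), 1, num_congr (by grind), num_congr (by grind), num_congr (by grind)⟩
  have p1 : ∀ k ≤ 2 * s, W (num 0 (x + (0 + zig s 1 k))) := by
    subst hW
    exact reach_top 0 x c1
  have c2 : W (num 2 (x + -1)) := step (p1 _ le_rfl)
    ⟨(Sum.inr 5, x - s), 2, num_congr (by grind), num_congr (by grind), num_congr (by grind)⟩
  have c3 : W (num 0 (x + -(s + 1))) := step c2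
    ⟨(Sum.inr 2, x - (s + 1)), 1, num_congr (by grind), num_congr (by grind), num_congr (by grind)⟩
  have c4 : W (num 1 (x + 1)) := step c3
    ⟨(Sum.inr 3, x - (s + 1)), 2, num_congr (by grind), num_congr (by grind), num_congr (by grind)⟩
  have c5 : W (num 0 (x + (2 * s + 1))) := step c4
    ⟨(Sum.inr 4, x - (2 * s + 2)), 1, num_congr (by grind), num_congr (by grind), num_congr (by grind)⟩
  have c6 : W (num 1 (x + (2 * s + 1))) := step c5
    ⟨(Sum.inr 1, x - (2 * s + 2)), 2, num_congr (by grind), num_congr (by grind), num_congr (by grind)⟩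
  have c7 : W (num 2 (x + (2 * s + 1))) := step c6
    ⟨(Sum.inr 6, x), 0, num_congr (by grind), num_congr (by grind), num_congr (by grind)⟩
  have p2 : ∀ k ≤ 2 * s + 1, W (num 2 (x + (2 * s + 1 - zig s 1 k))) := by
    subst hW
    exact reach_bot 2 x c7
  have cl : W (v) := step (p2 _ le_rfl)
    ⟨(Sum.inr 8, x), 1, num_congr (by grind), num_congr (by grind), rfl⟩
  have c8 : W (num 2 (x + -(s + 1))) := step cl
    ⟨(Sum.inr 9, x - (s + 1)), 2, num_congr (by grind), rfl, num_congr (by grind)⟩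
  have z1' : W (num 2 (x + -(0 + zig s 2 (2 * s - 1)))) := by
    convert c8 using 2
    grind
  -- Ladder `1` has oddly many rungs, so a pass switches rails.
  have z1 : W (num 0 (x + -(2 * s + 3))) := by
    subst hW
    simpa [len, gap, top, bot, Nat.not_even_iff_odd.2 (⟨s - 1, by omega⟩ : Odd (2 * s - 1))] using reach_zigzag_end 1 x z1'
  have c9 : W (num 1 (x + -1)) := step z1
    ⟨(Sum.inr 4, x - (2 * s + 3)), 2, num_congr (by grind), num_congr (by grind), num_congr (by grind)⟩
  have c10 : W (num 0 (x + -(s + 2))) := step c9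
    ⟨(Sum.inr 3, x - (s + 2)), 1, num_congr (by grind), num_congr (by grind), num_congr (by grind)⟩
  have z2' : W (num 0 (x + -(2 * s + 3 - zig s 2 (2 * s - 1)))) := by
    convert c10 using 2
    grind
  have z2 : W (num 2 (x + -0)) := by
    subst hW
    simpa [len, gap, top, bot, Nat.not_even_iff_odd.2 (⟨s - 1, by omega⟩ : Odd (2 * s - 1))] using reach_zigzag_end' 1 x z2'
  obtain ⟨hr, hm⟩ : (∀ k ≤ 2 * s - 1, W (num 2 (x + -(0 + zig s 2 k))) ∧
      W (num 0 (x + -(2 * s + 3 - zig s 2 k)))) ∧ ∀ n : ℕ, 2 ≤ n → n < 2 * s - 1 + 2 →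
      W (num 1 (x + n)) ∧ W (num 1 (x + -n)) := by
    subst hW
    exact reach_ladder 1 x z1' z2'
  refine ⟨forall_neighbor 1 (rung_cover fun n h1 h2 => ?_) ?_ ?_, cl⟩
  -- The differences `1` and `2 * s + 1` are the ones missing from ladder `1`.
  · obtain h | rfl | rfl : (2 ≤ n ∧ n < 2 * s - 1 + 2) ∨ n = 1 ∨ n = 2 * s + 1 := by omega
    · exact hm n h.1 h.2
    · exact ⟨by simpa using c4, by simpa using c9⟩
    · constructor
      · convert c6 using 3
        push_cast
        ring
      · convert c0 using 3
        push_cast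
        grind
  · have A := zig_cover (fun z => 2 * s + 1 - z) p2
    have B := zig_cover (fun z => -(0 + z)) fun k hk => (hr k hk).1
    intro d
    obtain ⟨n, hn, rfl⟩ := exists_natCast d
    obtain h | h | h | h | h : n + 1 ≤ s ∨ s ≤ n ∧ n ≤ 2 * s ∨ 2 * s + 1 ≤ n ∧ n ≤ 3 * s + 1 ∨ 3 * s + 2 ≤ n ∧ n ≤ 4 * s + 1 ∨ n = 4 * s + 2 := by omega
    · obtain ⟨j, hj⟩ : ∃ j, n = j := ⟨n, by omega⟩
      have e := cast_congr (s := s) hj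
      exact B.1 j (by omega) _ (by clear * - hq e; grind)
    · obtain ⟨j, hj⟩ : ∃ j, n + j = 2 * s := ⟨2 * s - n, by omega⟩
      have e := cast_congr (s := s) hj
      push_cast at e
      exact A.2 j (by omega) _ (by clear * - hq e; grind)
    · obtain ⟨j, hj⟩ : ∃ j, n = 2 * s + 1 + j := ⟨n - (2 * s + 1), by omega⟩
      have e := cast_congr (s := s) hj
      push_cast at e
      exact A.1 j (by omega) _ (by clear * - hq e; grind)
    · obtain ⟨j, hj⟩ : ∃ j, n + j = 4 * s + 1 := ⟨4 * s + 1 - n, by omega⟩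
      have e := cast_congr (s := s) hj
      push_cast at e
      exact B.2 j (by omega) _ (by clear * - hq e; grind)
    · have e := cast_congr (s := s) h
      push_cast at e
      rw [show (n : ZMod (4 * s + 3)) = -1 by clear * - hq e; grind]
      exact c2
  · have A := zig_cover (fun z => 0 + z) p1
    have B := zig_cover (fun z => -(2 * s + 3 - z)) fun k hk => (hr k hk).2
    intro d
    obtain ⟨n, hn, rfl⟩ := exists_natCast d
    obtain h | h | h | h | h | h | h : n = 0 ∨ 1 ≤ n ∧ n ≤ s ∨ s + 1 ≤ n ∧ n ≤ 2 * s ∨ n = 2 * s + 1 ∨ 2 * s + 2 ≤ n ∧ n ≤ 3 * s + 1 ∨ n = 3 * s + 2 ∨ 3 * s + 3 ≤ n := by omega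
    · obtain ⟨j, hj⟩ : ∃ j, n + j = 0 := ⟨0, by omega⟩
      have e := cast_congr (s := s) hj
      push_cast at e
      exact A.1 j (by omega) _ (by clear * - hq e; grind)
    · obtain ⟨j, hj⟩ : ∃ j, n = j + 1 := ⟨n - 1, by omega⟩
      have e := cast_congr (s := s) hj
      push_cast at e
      exact A.2 j (by omega) _ (by clear * - hq e; grind)
    · obtain ⟨j, hj⟩ : ∃ j, n + j = 2 * s := ⟨2 * s - n, by omega⟩
      have e := cast_congr (s := s) hj
      push_cast at e
      exact B.1 j (by omega) _ (by clear * - hq e; grind)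
    · have e := cast_congr (s := s) h
      push_cast at e
      rw [show (n : ZMod (4 * s + 3)) = 2 * s + 1 by clear * - hq e; grind]
      exact c5
    · obtain ⟨j, hj⟩ : ∃ j, n = 2 * s + 2 + j := ⟨n - (2 * s + 2), by omega⟩
      have e := cast_congr (s := s) hj
      push_cast at e
      exact B.2 j (by omega) _ (by clear * - hq e; grind)
    · have e := cast_congr (s := s) h
      push_cast at e
      rw [show (n : ZMod (4 * s + 3)) = -(s + 1) by clear * - hq e; grind]
      exact c3
    · obtain ⟨j, hj⟩ : ∃ j, n + j = 4 * s + 3 := ⟨4 * s + 3 - n, by omega⟩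
      have e := cast_congr (s := s) hj
      push_cast at e
      exact A.1 j (by omega) _ (by clear * - hq e; grind)

/-- The link of a numbered vertex of class `2` passes through all its neighbours. -/
theorem link_two (hs : 1 ≤ s) (x : ZMod (4 * s + 3)) :
    (∀ y, y ≠ (2, x) →
      TransGen (LinkStep (tri s) (num 2 x)) (num 1 (x + (2 * s + 2))) (Sum.inl y)) ∧
      TransGen (LinkStep (tri s) (num 2 x)) (num 1 (x + (2 * s + 2))) v := by
  have hq := four_mul_add_three (s := s)
  have e0 := zig_len_zero (s := s)
  have e1 := zig_len_one hs
  have e2 := zig_len_two (s := s)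
  have h0 : LinkStep (tri s) (num 2 x) (num 1 (x + (2 * s + 2))) (num 1 (x + 0)) :=
    ⟨(Sum.inr 6, x - (2 * s + 1)), 2, num_congr (by grind), num_congr (by grind), num_congr (by grind)⟩
  suffices h : (∀ y, y ≠ (2, x) →
      ReflTransGen (LinkStep (tri s) (num 2 x)) (num 1 (x + 0)) (Sum.inl y)) ∧
      ReflTransGen (LinkStep (tri s) (num 2 x)) (num 1 (x + 0)) v from
    ⟨fun y hy => TransGen.head' h0 (h.1 y hy), TransGen.head' h0 h.2⟩
  generalize hW : ReflTransGen (LinkStep (tri s) (num 2 x)) (num 1 (x + 0)) = W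
  have step : ∀ {y z}, W y → LinkStep (tri s) (num 2 x) y z → W z := by
    subst hW
    exact fun h h' => h.tail h'
  have c0 : W (num 1 (x + 0)) := by
    subst hW
    exact ReflTransGen.refl
  have p1 : ∀ k ≤ 2 * s - 1, W (num 1 (x + (0 + zig s 2 k))) := by
    subst hW
    exact reach_top 1 x c0
  have cl : W (v) := step (p1 _ le_rfl)
    ⟨(Sum.inr 9, x), 1, num_congr (by grind), num_congr (by grind), rfl⟩
  have c2 : W (num 1 (x + -s)) := step cl
    ⟨(Sum.inr 8, x - s), 2, num_congr (by grind), rfl, num_congr (by grind)⟩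
  have z1' : W (num 1 (x + -(2 * s + 1 - zig s 1 (2 * s + 1)))) := by
    convert c2 using 2
    grind
  -- The odd number `2 * s + 1` of rungs again makes the passes switch rails.
  have z1 : W (num 0 (x + -(-2))) := by
    subst hW
    simpa [len, gap, top, bot] using reach_zigzag_end' 2 x z1'
  have c3 : W (num 0 (x + (2 * s + 3))) := step z1
    ⟨(Sum.inr 0, x + 2), 2, num_congr (by grind), num_congr (by grind), num_congr (by grind)⟩
  have p2 : ∀ k ≤ 2 * s, W (num 0 (x + (2 * s + 3 - zig s 1 k))) := by
    subst hW
    exact reach_bot 0 x c3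
  have c4 : W (num 1 (x + 1)) := step (p2 _ le_rfl)
    ⟨(Sum.inr 2, x - s), 2, num_congr (by grind), num_congr (by grind), num_congr (by grind)⟩
  have c5 : W (num 0 (x + (1 - s))) := step c4
    ⟨(Sum.inr 5, x - (s - 1)), 1, num_congr (by grind), num_congr (by grind), num_congr (by grind)⟩
  have z2' : W (num 0 (x + -(-2 + zig s 1 (2 * s + 1)))) := by
    convert c5 using 2
    grind
  have z2 : W (num 1 (x + -(2 * s + 1))) := by
    subst hW
    simpa [len, gap, top, bot] using reach_zigzag_end 2 x z2'
  obtain ⟨hr, hm⟩ : (∀ k ≤ 2 * s + 1, W (num 0 (x + -(-2 + zig s 1 k))) ∧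
      W (num 1 (x + -(2 * s + 1 - zig s 1 k)))) ∧ ∀ n : ℕ, 1 ≤ n → n < 2 * s + 1 + 1 →
      W (num 2 (x + n)) ∧ W (num 2 (x + -n)) := by
    subst hW
    exact reach_ladder 2 x z2' z1'
  refine ⟨forall_neighbor 2 (rung_cover fun n h1 h2 => hm n h1 (by omega)) ?_ ?_, cl⟩
  · have A := zig_cover (fun z => 2 * s + 3 - z) p2
    have B := zig_cover (fun z => -(-2 + z)) fun k hk => (hr k hk).1
    intro d
    obtain ⟨n, hn, rfl⟩ := exists_natCast d
    obtain h | h | h | h | h : n < 2 ∨ 2 ≤ n ∧ n ≤ s + 2 ∨ s + 3 ≤ n ∧ n ≤ 2 * s + 2 ∨ 2 * s + 3 ≤ n ∧ n ≤ 3 * s + 3 ∨ 3 * s + 4 ≤ n := by omega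
    · obtain ⟨j, hj⟩ : ∃ j, n + j = 1 := ⟨1 - n, by omega⟩
      have e := cast_congr (s := s) hj
      push_cast at e
      exact B.2 j (by omega) _ (by clear * - hq e; grind)
    · obtain ⟨j, hj⟩ : ∃ j, n = j + 2 := ⟨n - 2, by omega⟩
      have e := cast_congr (s := s) hj
      push_cast at e
      exact B.1 j (by omega) _ (by clear * - hq e; grind)
    · obtain ⟨j, hj⟩ : ∃ j, n + j = 2 * s + 2 := ⟨2 * s + 2 - n, by omega⟩
      have e := cast_congr (s := s) hj
      push_cast at e
      exact A.2 j (by omega) _ (by clear * - hq e; grind)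
    · obtain ⟨j, hj⟩ : ∃ j, n = 2 * s + 3 + j := ⟨n - (2 * s + 3), by omega⟩
      have e := cast_congr (s := s) hj
      push_cast at e
      exact A.1 j (by omega) _ (by clear * - hq e; grind)
    · obtain ⟨j, hj⟩ : ∃ j, n + j = 4 * s + 4 := ⟨4 * s + 4 - n, by omega⟩
      have e := cast_congr (s := s) hj
      push_cast at e
      exact B.2 j (by omega) _ (by clear * - hq e; grind)
  · have A := zig_cover (fun z => 0 + z) p1
    have B := zig_cover (fun z => -(2 * s + 1 - z)) fun k hk => (hr k hk).2
    intro d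
    obtain ⟨n, hn, rfl⟩ := exists_natCast d
    -- Only the residue `1` lies on neither rail.
    obtain h | h | h | h | h | h : n = 0 ∨ n = 1 ∨ 2 ≤ n ∧ n ≤ s + 1 ∨ s + 2 ≤ n ∧ n ≤ 2 * s + 2 ∨ 2 * s + 3 ≤ n ∧ n ≤ 3 * s + 3 ∨ 3 * s + 4 ≤ n := by omega
    · obtain ⟨j, hj⟩ : ∃ j, n + j = 0 := ⟨0, by omega⟩
      have e := cast_congr (s := s) hj
      push_cast at e
      exact A.1 j (by omega) _ (by clear * - hq e; grind)
    · have e := cast_congr (s := s) h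
      push_cast at e
      rw [show (n : ZMod (4 * s + 3)) = 1 by clear * - hq e; grind]
      exact c4
    · obtain ⟨j, hj⟩ : ∃ j, n = j + 2 := ⟨n - 2, by omega⟩
      have e := cast_congr (s := s) hj
      push_cast at e
      exact A.2 j (by omega) _ (by clear * - hq e; grind)
    · obtain ⟨j, hj⟩ : ∃ j, n + j = 2 * s + 2 := ⟨2 * s + 2 - n, by omega⟩
      have e := cast_congr (s := s) hj
      push_cast at e
      exact B.1 j (by omega) _ (by clear * - hq e; grind)
    · obtain ⟨j, hj⟩ : ∃ j, n = 2 * s + 3 + j := ⟨n - (2 * s + 3), by omega⟩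
      have e := cast_congr (s := s) hj
      push_cast at e
      exact B.2 j (by omega) _ (by clear * - hq e; grind)
    · obtain ⟨j, hj⟩ : ∃ j, n + j = 4 * s + 3 := ⟨4 * s + 3 - n, by omega⟩
      have e := cast_congr (s := s) hj
      push_cast at e
      exact A.1 j (by omega) _ (by clear * - hq e; grind)

/-! ### The graph and the adjacency of triangle corners. -/

/-- The split-complete graph: `u` is adjacent to the numbered vertices of class `0`, and `v` to
those of the classes `1` and `2`. -/
def graph (s : ℕ) : SimpleGraph (SplitVertex s) where
  Adj
    | Sum.inl a, Sum.inl b => a ≠ b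
    | Sum.inl a, Sum.inr c => a.1 = 0 ↔ c = true
    | Sum.inr c, Sum.inl a => a.1 = 0 ↔ c = true
    | Sum.inr _, Sum.inr _ => False
  symm := ⟨by
    rintro (a | c) (b | d) h
    exacts [Ne.symm h, h, h, h]⟩
  loopless := ⟨by
    rintro (a | c) h
    exacts [h rfl, h]⟩

theorem graph_adj_translate {a b : SplitVertex s} (g : ZMod (4 * s + 3)) (h : (graph s).Adj a b) :
    (graph s).Adj (translate g a) (translate g b) := by
  rcases a with ⟨r, x⟩ | c <;> rcases b with ⟨t, y⟩ | d
  · refine fun h' => h ?_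
    obtain ⟨h1, h2⟩ := Prod.ext_iff.1 h'
    exact Prod.ext h1 (add_right_cancel h2)
  all_goals exact h

theorem natCast_ne_zero {n : ℕ} (h0 : 0 < n) (h1 : n < 4 * s + 3) : (n : ZMod (4 * s + 3)) ≠ 0 :=
  fun h => absurd (Nat.le_of_dvd h0 ((ZMod.natCast_eq_zero_iff _ _).1 h)) (by omega)

theorem num_adj {r : Fin 3} {x y : ZMod (4 * s + 3)} (h : x ≠ y) :
    (graph s).Adj (num r x) (num r y) :=
  fun h' => h (Prod.ext_iff.1 h').2

theorem num_adj_of_ne {r t : Fin 3} (x y : ZMod (4 * s + 3)) (h : r ≠ t) :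
    (graph s).Adj (num r x) (num t y) :=
  fun h' => h (Prod.ext_iff.1 h').1

theorem zig_ne {r : Fin 3} {k : ℕ} (hk : k < len s r) :
    zig s (gap r) (k + 1) - zig s (gap r) k ≠ 0 := by
  have h : k + gap r < 4 * s + 3 ∧ 0 < gap r := by
    fin_cases r <;> simp [len, gap] at hk ⊢ <;> omega
  have h' := natCast_ne_zero (n := k + gap r) (by omega) h.1
  rcases zig_step (s := s) (gap r) k with e | e
  · rwa [e]
  · rwa [e, neg_ne_zero]

theorem adj_tri (j : ((Σ r : Fin 3, Fin (len s r) × Bool) ⊕ Fin 10) × ZMod (4 * s + 3))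
    (k : Fin 3) : (graph s).Adj (tri s j k) (tri s j (k + 1)) := by
  refine graph_adj_translate _ ?_
  have hr1 : ∀ r : Fin 3, r + 1 ≠ r := by decide
  have hr2 : ∀ r : Fin 3, r + 2 ≠ r := by decide
  obtain ⟨⟨r, i, b⟩ | i, g⟩ := j
  · have hz := zig_ne i.2
    cases b <;> fin_cases k
    · exact num_adj_of_ne _ _ (hr2 r)
    · exact num_adj fun h => hz (by linear_combination h)
    · exact num_adj_of_ne _ _ (hr2 r).symm
    · exact num_adj_of_ne _ _ (hr1 r)
    · exact num_adj fun h => hz (by linear_combination -h)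
    · exact num_adj_of_ne _ _ (hr1 r).symm
  · have hq := four_mul_add_three (s := s)
    have h1 : (1 : ZMod (4 * s + 3)) ≠ 0 := by
      simpa using natCast_ne_zero (s := s) (n := 1) (by omega) (by omega)
    -- The sides within a class have difference `±1` or `±(2s+1)`; the latter is nonzero because
    -- `2(2s+1) = -1`.
    fin_cases i <;> fin_cases k <;>
      first
      | exact num_adj_of_ne _ _ (by decide)
      | exact iff_of_true rfl rfl
      | exact iff_of_false (Fin.zero_ne_one.symm : (1 : Fin 3) ≠ 0) Bool.false_ne_true
      | exact iff_of_false (show (2 : Fin 3) ≠ 0 by decide) Bool.false_ne_true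
      | (refine num_adj ?_; grind)

/-! ### Links of the two letters. -/

theorem link_u (x y : ZMod (4 * s + 3)) : TransGen (LinkStep (tri s) u) (num 0 x) (num 0 y) := by
  have hq := four_mul_add_three (s := s)
  have step : ∀ x, LinkStep (tri s) u (num 0 x) (num 0 (x + (2 * s + 2))) := fun x =>
    ⟨(Sum.inr 7, x), 0, rfl, num_congr (by ring), num_congr (by ring)⟩
  have key : ∀ n : ℕ, TransGen (LinkStep (tri s) u) (num 0 x)
      (num 0 (x + (n + 1) * (2 * s + 2))) := by
    intro n
    induction n with
    | zero => simpa using TransGen.single (step x)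
    | succ n ih =>
      refine ih.tail ?_
      convert step (x + (n + 1) * (2 * s + 2)) using 2
      push_cast
      ring
  -- Since `2(2s+2) = 1`, the step `2s+2` generates the group, and `2(y - x)` steps lead from `x` to
  -- `y`.
  obtain ⟨n, -, hn⟩ := exists_natCast (2 * (y - x) - 1)
  convert key n using 2
  rw [hn]
  linear_combination (x - y) * hq

theorem link_v (x y : ZMod (4 * s + 3)) : TransGen (LinkStep (tri s) v) (num 1 x) (num 1 y) ∧
    TransGen (LinkStep (tri s) v) (num 1 x) (num 2 y) := by
  have hq := four_mul_add_three (s := s)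
  have step : ∀ x, LinkStep (tri s) v (num 1 x) (num 2 (x + s)) := fun x =>
    ⟨(Sum.inr 8, x), 0, rfl, num_congr (by ring), num_congr (by ring)⟩
  have step' : ∀ x, LinkStep (tri s) v (num 2 x) (num 1 (x + (s + 1))) := fun x =>
    ⟨(Sum.inr 9, x), 0, rfl, num_congr (by ring), num_congr (by ring)⟩
  have key : ∀ n : ℕ, TransGen (LinkStep (tri s) v) (num 1 x)
      (num 1 (x + (n + 1) * (2 * s + 1))) := by
    intro n
    induction n with
    | zero =>
      convert (TransGen.single (step x)).tail (step' _) using 2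
      push_cast
      ring
    | succ n ih =>
      convert (ih.tail (step _)).tail (step' _) using 2
      push_cast
      ring
  have h1 : ∀ y, TransGen (LinkStep (tri s) v) (num 1 x) (num 1 y) := by
    intro y
    -- Two steps together translate by `2s+1`, and `2(2s+1) = -1`.
    obtain ⟨n, -, hn⟩ := exists_natCast (-2 * (y - x) - 1)
    convert key n using 2
    rw [hn]
    linear_combination (y - x) * hq
  refine ⟨h1 y, ?_⟩
  convert (h1 (y - s)).tail (step _) using 2
  ring

theorem link (hs : 1 ≤ s) (a : SplitVertex s) :
    ∃ b, ∀ c, (graph s).Adj a c → TransGen (LinkStep (tri s) a) b c := by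
  have hr : ∀ r : Fin 3, r = 0 ∨ r = 1 ∨ r = 2 := by decide
  rcases a with ⟨r, x⟩ | (_ | _)
  · rcases hr r with rfl | rfl | rfl
    · have h := link_zero hs x
      refine ⟨num 1 x, ?_⟩
      · rintro (y | (_ | _)) hc
        · exact h.1 y (Ne.symm hc)
        · exact absurd (hc.1 rfl) (by decide)
        · exact h.2
    · have h := link_one hs x
      refine ⟨num 2 x, ?_⟩
      · rintro (y | (_ | _)) hc
        · exact h.1 y (Ne.symm hc)
        · exact h.2
        · exact absurd (hc.2 rfl) (show (1 : Fin 3) ≠ 0 by decide)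
    · have h := link_two hs x
      refine ⟨num 1 (x + (2 * s + 2)), ?_⟩
      · rintro (y | (_ | _)) hc
        · exact h.1 y (Ne.symm hc)
        · exact h.2
        · exact absurd (hc.2 rfl) (show (2 : Fin 3) ≠ 0 by decide)
  · refine ⟨num 1 0, ?_⟩
    rintro (⟨r, y⟩ | _) hc
    · rcases hr r with rfl | rfl | rfl
      · exact absurd (hc.1 rfl) (by decide)
      · exact (link_v 0 y).1
      · exact (link_v 0 y).2
    · exact hc.elim
  · refine ⟨num 0 0, ?_⟩
    rintro (⟨r, y⟩ | _) hc
    · obtain rfl : r = 0 := hc.2 rfl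
      exact link_u 0 y
    · exact hc.elim

/-! ### Connectedness and counting. -/

theorem graph_connected (s : ℕ) : (graph s).Connected := by
  have h : ∀ a, (graph s).Reachable (num 0 0) a := by
    have hn : ∀ y, (graph s).Reachable (num 0 0) (Sum.inl y) := by
      intro y
      by_cases hy : ((0, 0) : Fin 3 × ZMod (4 * s + 3)) = y
      · subst hy
        exact SimpleGraph.Reachable.refl _
      · exact SimpleGraph.Adj.reachable (G := graph s) hy
    rintro (y | (_ | _))
    · exact hn y
    · refine (hn (1, 0)).trans (SimpleGraph.Adj.reachable ?_)
      exact iff_of_false (show (1 : Fin 3) ≠ 0 by decide) Bool.false_ne_true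
    · exact (hn (0, 0)).trans (SimpleGraph.Adj.reachable (iff_of_true rfl rfl))
  have : Nonempty (SplitVertex s) := ⟨u⟩
  exact ⟨fun a b => (h a).symm.trans (h b)⟩

/-- With `N = 3(4s+3)` numbered vertices, each is adjacent to the `N - 1` others and to exactly one
letter. The degrees thus sum to `N² + N`. -/
theorem card_edgeSet (s : ℕ) :
    Nat.card (graph s).edgeSet = 3 * (4 * s + 3) * (6 * s + 5) := by
  classical
  have hN : Fintype.card (Fin 3 × ZMod (4 * s + 3)) = 3 * (4 * s + 3) := by
    rw [Fintype.card_prod, Fintype.card_fin, ZMod.card]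
  have h := (graph s).sum_degrees_eq_twice_card_edges
  have hdeg : ∀ a, (graph s).degree a = ∑ b, if (graph s).Adj a b then 1 else 0 := by
    intro a
    rw [← SimpleGraph.card_neighborFinset_eq_degree, SimpleGraph.neighborFinset_eq_filter,
      Finset.card_filter]
  have hnum : ∀ a, (graph s).degree (Sum.inl a) = 3 * (4 * s + 3) := by
    intro a
    have h1 : ∀ b, (graph s).Adj (Sum.inl a) (Sum.inl b) ↔ a ≠ b := fun b => Iff.rfl
    have h2 : ∀ c, (graph s).Adj (Sum.inl a) (Sum.inr c) ↔ (a.1 = 0 ↔ c = true) := fun c => Iff.rfl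
    rw [hdeg, Fintype.sum_sum_type, Fintype.sum_bool]
    simp only [h1, h2, ← Finset.card_filter, Finset.filter_ne, Finset.card_erase_of_mem,
      Finset.mem_univ, Finset.card_univ, hN]
    by_cases h0 : a.1 = 0 <;> simp [h0] <;> omega
  have hlet : (graph s).degree (Sum.inr true) + (graph s).degree (Sum.inr false) =
      3 * (4 * s + 3) := by
    have h1 : ∀ a c, (graph s).Adj (Sum.inr c) (Sum.inl a) ↔ (a.1 = 0 ↔ c = true) :=
      fun a c => Iff.rfl
    have h2 : ∀ c d, ¬ (graph s).Adj (Sum.inr c) (Sum.inr d) := fun c d h => h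
    rw [hdeg, hdeg, Fintype.sum_sum_type, Fintype.sum_sum_type, Fintype.sum_bool,
      Fintype.sum_bool]
    simp only [h1, h2, if_false, add_zero]
    rw [← Finset.sum_add_distrib, ← hN, ← Finset.card_univ, Finset.card_eq_sum_ones]
    refine Finset.sum_congr rfl fun a _ => ?_
    by_cases h0 : a.1 = 0 <;> simp [h0]
  rw [Fintype.sum_sum_type, Fintype.sum_bool, hlet, Finset.sum_congr rfl fun a _ => hnum a,
    Finset.sum_const, Finset.card_univ, hN, smul_eq_mul, SimpleGraph.edgeFinset_card,
    ← Nat.card_eq_fintype_card] at h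
  linarith [h, show 3 * (4 * s + 3) * (3 * (4 * s + 3)) + 3 * (4 * s + 3) =
    2 * (3 * (4 * s + 3) * (6 * s + 5)) by ring]

theorem card_triangles (hs : 1 ≤ s) :
    Nat.card (((Σ r : Fin 3, Fin (len s r) × Bool) ⊕ Fin 10) × ZMod (4 * s + 3)) =
      (12 * s + 10) * (4 * s + 3) := by
  have h : 2 * s * 2 + (2 * s - 1) * 2 + (2 * s + 1) * 2 = 12 * s := by omega
  simp [Nat.card_eq_fintype_card, Fin.sum_univ_three, len, ZMod.card, h]

theorem card_splitVertex (s : ℕ) : Fintype.card (SplitVertex s) = 12 * s + 11 := by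
  simp [ZMod.card]
  ring

end SplitVertex

/-! ### Transport to `Fin (12 * s + 11)` and the genus. -/

open SplitVertex in
/-- For every `s ≥ 1` there is a split-complete graph `K̂_{12s+10}` (on `12s+11` vertices) with a
triangular cellular embedding in some orientable surface `S_g`. -/
theorem mainTheorem6 (s : ℕ) (hs : 1 ≤ s) :
    ∃ G : SimpleGraph (Fin (12 * s + 11)),
      IsSplitComplete (12 * s + 10) G ∧
      ∃ (R : RotationSystem G) (g : ℕ), R.IsCellularEmbedding g ∧ R.IsTriangular := by
  let e : SplitVertex s ≃ Fin (12 * s + 11) := Fintype.equivFinOfCardEq (card_splitVertex s)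
  let G : SimpleGraph (Fin (12 * s + 11)) := (graph s).comap e.symm
  have hG : ∀ a b, G.Adj (e a) (e b) ↔ (graph s).Adj a b := fun a b => by
    simp [G]
  have hiso : G ≃g graph s := SimpleGraph.Iso.comap e.symm (graph s)
  have hedge : Nat.card G.edgeSet = 3 * (4 * s + 3) * (6 * s + 5) :=
    (Nat.card_congr hiso.mapEdgeSet).trans (card_edgeSet s)
  obtain ⟨R, hR, hface⟩ := exists_isTriangular_of_linkStep (G := G) (fun j k => e (tri s j k))
    (fun j k => (hG _ _).2 (adj_tri j k)) (fun a => by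
      obtain ⟨a, rfl⟩ := e.surjective a
      obtain ⟨b, hb⟩ := link hs a
      refine ⟨e b, fun c hc => ?_⟩
      obtain ⟨c, rfl⟩ := e.surjective c
      refine Relation.TransGen.lift e ?_ _ _ (hb c ((hG _ _).1 hc))
      rintro _ _ ⟨j, k, h0, h1, h2⟩
      exact ⟨j, k, congrArg e h0, congrArg e h1, congrArg e h2⟩) (by
      rw [card_triangles hs, hedge]
      exact le_of_eq (by ring))
  -- The genus is obtained by solving Euler's formula with `|F| = (12s+10)(4s+3)`.
  refine ⟨G, ⟨by omega, ?_⟩, R, (4 * s + 3) * (3 * s + 1), ⟨?_, ?_⟩, hR⟩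
  · let f : Fin (12 * s + 10 - 1) ≃ Fin 3 × ZMod (4 * s + 3) := Fintype.equivOfCardEq (by
      rw [Fintype.card_fin, Fintype.card_prod, Fintype.card_fin, ZMod.card]
      omega)
    have hrange : Set.range (fun i => e (Sum.inl (f i))) = e '' Set.range Sum.inl := by
      rw [← Set.range_comp, ← f.surjective.range_comp]
      rfl
    have hu : G.neighborSet (e u) = e '' {a | ∃ x, a = num 0 x} := by
      ext a
      obtain ⟨a, rfl⟩ := e.surjective a
      rw [SimpleGraph.mem_neighborSet, hG, e.injective.mem_set_image]
      rcases a with ⟨r, x⟩ | c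
      · exact ⟨fun h => ⟨x, by rw [num, show r = 0 from h.2 rfl]⟩, fun ⟨y, h⟩ =>
          iff_of_true (congrArg Prod.fst (Sum.inl.inj h)) rfl⟩
      · exact ⟨fun h => h.elim, fun ⟨_, h⟩ => nomatch h⟩
    have hv : G.neighborSet (e v) = e '' {a | ∃ r x, r ≠ 0 ∧ a = num r x} := by
      ext a
      obtain ⟨a, rfl⟩ := e.surjective a
      rw [SimpleGraph.mem_neighborSet, hG, e.injective.mem_set_image]
      rcases a with ⟨r, x⟩ | c
      · exact ⟨fun h => ⟨r, x, fun h0 => absurd (h.1 h0) (by decide), rfl⟩, fun ⟨t, y, h0, h⟩ =>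
          iff_of_false (by rw [(Prod.ext_iff.1 (Sum.inl.inj h)).1]; exact h0) (by decide)⟩
      · exact ⟨fun h => h.elim, fun ⟨_, _, _, h⟩ => nomatch h⟩
    refine ⟨fun i => e (Sum.inl (f i)), e u, e v, ?_, ?_, ?_, ?_, ?_, ?_, ?_, ?_, ?_, ?_⟩
    · exact e.injective.comp (Sum.inl_injective.comp f.injective)
    · exact e.injective.ne (by simp [u, v])
    · rintro ⟨i, hi⟩
      exact nomatch e.injective hi
    · rintro ⟨i, hi⟩
      exact nomatch e.injective hi
    · refine Set.eq_univ_of_forall fun a => ?_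
      obtain ⟨a, rfl⟩ := e.surjective a
      rcases a with x | (_ | _)
      · exact Or.inl (hrange ▸ ⟨_, ⟨x, rfl⟩, rfl⟩)
      · exact Or.inr (Or.inr rfl)
      · exact Or.inr (Or.inl rfl)
    · intro i j hij
      exact (hG _ _).2 (f.injective.ne hij)
    · exact hu ▸ ⟨e (num 0 0), _, ⟨0, rfl⟩, rfl⟩
    · exact hv ▸ ⟨e (num 1 0), _, ⟨1, 0, by decide, rfl⟩, rfl⟩
    · rw [hu, hv, Set.disjoint_image_iff e.injective, Set.disjoint_left]
      rintro _ ⟨x, rfl⟩ ⟨r, y, h0, h⟩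
      exact h0 (Prod.ext_iff.1 (Sum.inl.inj h)).1.symm
    · rw [hu, hv, hrange, ← Set.image_union]
      congr 1
      ext a
      constructor
      · rintro (⟨x, rfl⟩ | ⟨r, x, -, rfl⟩)
        exacts [⟨_, rfl⟩, ⟨_, rfl⟩]
      · rintro ⟨⟨r, x⟩, rfl⟩
        by_cases h0 : r = 0
        · exact Or.inl ⟨x, by rw [h0, num]⟩
        · exact Or.inr ⟨r, x, h0, rfl⟩
  · exact hiso.connected_iff.2 (graph_connected s)
  · rw [hface, hedge, card_triangles hs, Nat.card_fin]
    push_cast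
    ring
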